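/- A Random Apollonian Network (RAN) is generated as follows. Start with a triangle embedded in the plane. In each step, choose a bounded face uniformly at random (independently of the past given the current graph), add a new vertex inside that face, and join it to the three vertices of the face. After $k\ge 0$ steps the resulting plane graph has $m=2k+1$ bounded faces (all of them triangles). Let $\mathcal{L}_m$ denote the number of vertices in a longest (simple) path of a RAN with $m$ bounded faces. Then, for every positive integer $m$ that is the number of bounded faces of a RAN (that is, $m=2k+1$ with $k\ge 0$ an integer): (a) Deterministically, that is, for every graph with $m$ bounded faces that can arise from this process, $$\mathcal{L}_m \ \ge\ m^{\log 2/\log 3}+2 .$$ (b) $\mathbb{E}[\mathcal{L}_m]=\Omega\left(m^{0.88}\right)$; that is, there is an absolute constant $c>0$ such that $\mathbb{E}[\mathcal{L}_m]\ge c\,m^{0.88}$ for every such $m$. -/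

import Mathlib

/-- A finite graph with vertex set `{0, …, order - 1}`, together with the list of its bounded faces.
A bounded face is a triangle of the graph, recorded as the set of its three vertices. -/
structure FacedGraph where
  /-- the number of vertices -/
  order : ℕ
  /-- the edges -/
  graph : SimpleGraph ℕ
  /-- the bounded faces -/
  faces : Finset (Finset ℕ)
  adj_lt : ∀ u v, graph.Adj u v → u < order ∧ v < order
  faces_nonempty : faces.Nonempty
  face_lt : ∀ f ∈ faces, ∀ v ∈ f, v < order
  face_card : ∀ f ∈ faces, f.card = 3
  face_clique : ∀ f ∈ faces, graph.IsClique (f : Set ℕ)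

namespace FacedGraph

/-- A single triangle embedded in the plane: three mutually adjacent vertices, one bounded face. -/
def triangle : FacedGraph where
  order := 3
  graph := SimpleGraph.fromRel fun u v => u < 3 ∧ v < 3
  faces := {{0, 1, 2}}
  adj_lt u v h := by
    rw [SimpleGraph.fromRel_adj] at h
    omega
  faces_nonempty := Finset.singleton_nonempty _
  face_lt f hf v hv := by
    rw [Finset.mem_singleton] at hf
    subst hf
    simp at hv
    omega
  face_card f hf := by
    rw [Finset.mem_singleton] at hf
    subst hf
    rfl
  face_clique f hf := by
    rw [Finset.mem_singleton] at hf
    subst hf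
    intro u hu v hv huv
    simp at hu hv
    rw [SimpleGraph.fromRel_adj]
    exact ⟨huv, by omega⟩

/-- Subdividing the bounded face `f`: a new vertex is put inside `f` and joined to the three
vertices of `f`; the face `f` is replaced by the three triangles formed by the new vertex and two of
the vertices of `f`. -/
def subdivide (G : FacedGraph) (f : Finset ℕ) (hf : f ∈ G.faces) : FacedGraph where
  order := G.order + 1
  graph := G.graph ⊔ SimpleGraph.fromRel fun u v => u = G.order ∧ v ∈ f
  faces := G.faces.erase f ∪ f.image fun v => insert G.order (f.erase v)
  adj_lt u v h := by
    rw [SimpleGraph.sup_adj, SimpleGraph.fromRel_adj] at h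
    rcases h with h | ⟨_, ⟨h, h'⟩ | ⟨h, h'⟩⟩
    · have := G.adj_lt u v h
      omega
    · have := G.face_lt f hf v h'
      omega
    · have := G.face_lt f hf u h'
      omega
  faces_nonempty := by
    have h : f.Nonempty := Finset.card_pos.1 (by rw [G.face_card f hf]; norm_num)
    exact (h.image _).mono Finset.subset_union_right
  face_lt g hg v hv := by
    rw [Finset.mem_union, Finset.mem_image] at hg
    rcases hg with hg | ⟨w, _, rfl⟩
    · have := G.face_lt g (Finset.mem_of_mem_erase hg) v hv
      omega
    · rcases Finset.mem_insert.1 hv with h | h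
      · omega
      · have := G.face_lt f hf v (Finset.mem_of_mem_erase h)
        omega
  face_card g hg := by
    rw [Finset.mem_union, Finset.mem_image] at hg
    rcases hg with hg | ⟨w, hw, rfl⟩
    · exact G.face_card g (Finset.mem_of_mem_erase hg)
    · rw [Finset.card_insert_of_notMem, Finset.card_erase_of_mem hw, G.face_card f hf]
      intro h
      exact lt_irrefl _ (G.face_lt f hf _ (Finset.mem_of_mem_erase h))
  face_clique g hg := by
    rw [Finset.mem_union, Finset.mem_image] at hg
    rcases hg with hg | ⟨w, hw, rfl⟩
    · exact (G.face_clique g (Finset.mem_of_mem_erase hg)).mono le_sup_left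
    · intro u hu v hv huv
      rw [SimpleGraph.sup_adj, SimpleGraph.fromRel_adj]
      rcases Finset.mem_insert.1 (Finset.mem_coe.1 hu) with hu | hu <;>
        rcases Finset.mem_insert.1 (Finset.mem_coe.1 hv) with hv | hv
      · exact absurd (hu.trans hv.symm) huv
      · exact Or.inr ⟨huv, Or.inl ⟨hu, Finset.mem_of_mem_erase hv⟩⟩
      · exact Or.inr ⟨huv, Or.inr ⟨hv, Finset.mem_of_mem_erase hu⟩⟩
      · exact Or.inl (G.face_clique f hf (Finset.mem_of_mem_erase hu)
          (Finset.mem_of_mem_erase hv) huv)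

/-- Subdividing a face increases the number of bounded faces by two. -/
theorem card_faces_subdivide (G : FacedGraph) (f : Finset ℕ) (hf : f ∈ G.faces) :
    (G.subdivide f hf).faces.card = G.faces.card + 2 := by
  have hnot : G.order ∉ f := fun h => lt_irrefl _ (G.face_lt f hf _ h)
  have hdisj : Disjoint (G.faces.erase f) (f.image fun v => insert G.order (f.erase v)) := by
    rw [Finset.disjoint_right]
    intro g hg hg'
    obtain ⟨w, _, rfl⟩ := Finset.mem_image.1 hg
    exact lt_irrefl _ (G.face_lt _ (Finset.mem_of_mem_erase hg') _ (Finset.mem_insert_self _ _))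
  have hinj : Set.InjOn (fun v => insert G.order (f.erase v)) (f : Set ℕ) := by
    intro u hu v hv h
    by_contra huv
    have h1 : u ∈ insert G.order (f.erase v) :=
      Finset.mem_insert_of_mem (Finset.mem_erase.2 ⟨huv, hu⟩)
    rw [← show insert G.order (f.erase u) = insert G.order (f.erase v) from h,
      Finset.mem_insert] at h1
    rcases h1 with h1 | h1
    · exact hnot (h1 ▸ hu)
    · exact Finset.notMem_erase u f h1
  have hpos : 0 < G.faces.card := Finset.card_pos.2 G.faces_nonempty
  change (G.faces.erase f ∪ f.image fun v => insert G.order (f.erase v)).card = _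
  rw [Finset.card_union_of_disjoint hdisj, Finset.card_image_of_injOn hinj,
    Finset.card_erase_of_mem hf, G.face_card f hf]
  omega

/-- `G.IsApollonian` : the graph `G` is a possible value of a random Apollonian network, i.e. it
arises from a triangle by finitely many successive subdivisions of bounded faces. -/
inductive IsApollonian : FacedGraph → Prop
  | triangle : IsApollonian FacedGraph.triangle
  | subdivide (G : FacedGraph) (f : Finset ℕ) (hf : f ∈ G.faces) :
      IsApollonian G → IsApollonian (G.subdivide f hf)

/-- The number of vertices of a longest (simple) path of `G`. -/
noncomputable def longestPath (G : FacedGraph) : ℕ :=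
  sSup {l : ℕ | ∃ (u v : ℕ) (p : G.graph.Walk u v),
    p.IsPath ∧ (∀ w ∈ p.support, w < G.order) ∧ p.support.length = l}

/-- One random step: a uniformly random bounded face of `G` is subdivided. -/
noncomputable def randomStep (G : FacedGraph) : PMF FacedGraph :=
  (PMF.uniformOfFinset G.faces.attach G.faces_nonempty.attach).map fun f => G.subdivide f.1 f.2

/-- The law of the random Apollonian network after `k` random subdivisions of a triangle. -/
noncomputable def randomApollonian : ℕ → PMF FacedGraph
  | 0 => PMF.pure triangle
  | k + 1 => (randomApollonian k).bind randomStep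

/-- After `k` random subdivisions there are almost surely `2 * k + 1` bounded faces. -/
theorem card_faces_of_mem_support (k : ℕ) (G : FacedGraph)
    (hG : G ∈ (randomApollonian k).support) : G.faces.card = 2 * k + 1 := by
  induction k generalizing G with
  | zero =>
    rw [randomApollonian, PMF.mem_support_pure_iff] at hG
    subst hG
    rfl
  | succ k ih =>
    rw [randomApollonian, PMF.mem_support_bind_iff] at hG
    obtain ⟨H, hH, hG⟩ := hG
    rw [randomStep, PMF.mem_support_map_iff] at hG
    obtain ⟨f, _, rfl⟩ := hG
    rw [card_faces_subdivide, ih H hH]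
    ring

/-- The Apollonian networks are exactly the graphs that the random process reaches with positive
probability. -/
theorem isApollonian_iff (G : FacedGraph) :
    G.IsApollonian ↔ ∃ k, G ∈ (randomApollonian k).support := by
  constructor
  · intro h
    induction h with
    | triangle => exact ⟨0, by rw [randomApollonian, PMF.mem_support_pure_iff]⟩
    | subdivide G f hf _ ih =>
      obtain ⟨k, hk⟩ := ih
      refine ⟨k + 1, ?_⟩
      rw [randomApollonian, PMF.mem_support_bind_iff]
      refine ⟨G, hk, ?_⟩
      rw [randomStep, PMF.mem_support_map_iff]
      exact ⟨⟨f, hf⟩, by simp, rfl⟩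
  · rintro ⟨k, hk⟩
    induction k generalizing G with
    | zero =>
      rw [randomApollonian, PMF.mem_support_pure_iff] at hk
      subst hk
      exact IsApollonian.triangle
    | succ k ih =>
      rw [randomApollonian, PMF.mem_support_bind_iff] at hk
      obtain ⟨H, hH, hG⟩ := hk
      rw [randomStep, PMF.mem_support_map_iff] at hG
      obtain ⟨f, _, rfl⟩ := hG
      exact IsApollonian.subdivide H f.1 f.2 (ih H hH)

/-- The law of the number of vertices of a longest path in the random Apollonian network obtained
after `k` subdivisions, i.e. in the one with `m = 2 * k + 1` bounded faces. -/
noncomputable def longestPathLaw (k : ℕ) : PMF ℕ :=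
  (randomApollonian k).map longestPath

end FacedGraph

/-! Encode a history of subdivisions by a ternary tree: inner nodes are the inserted vertices,
leaves are the bounded faces. If `v` divides the triangle with corners `a`, `b`, `c`, then any two
of the three parts can be traversed one after the other through `v`, giving a path between any two
prescribed corners that avoids the third. So the sum of the two largest values over the three
children is a valid bound at each node, for all three pairs of corners at once
(`Represents.hasLongPath`). This bound is `pathLength`; the edge to the third corner turns it into
`pathLength + 2` vertices.

(a) If `α = log 2 / log 3`, then `3 ^ α = 2`, and concavity of `t ^ α` shows that the `α`-th powers
of the two largest of three positive numbers add up to at least the `α`-th power of the total.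
Induction on the tree finishes.

(b) The sizes of the three subtrees of the root form a Pólya urn in which a colour drawn `a` times
has weight `2 * a + 1`; given the sizes, the subtrees are independent random trees. Hence the mean
`f` of `pathLength` satisfies `f (k + 1) ≥ E[f A + f B + f C - f (min A B C)]`. Compare `f` with
`potential`, which grows at least like `k ^ 0.88` and is an eigenfunction of the urn in each
coordinate. In units of `potentialGrowth k`, the three coordinates contribute `3` and the induction
needs `2.76`, so the smallest entry may cost at most `0.24`. Its relative cost never increases with
`k` (`urn_minPotential_le`), so one exact computation at `k = 80` suffices (`minTable_eighty`). The
smaller cases are absorbed into the constant. Pairing faces with leaves (`Models.exists_expansions`)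
transfers the bound to the random graphs. -/

/-! ### Ternary trees -/

/-- Rooted trees in which every inner node has exactly three (ordered) children. -/
inductive TernaryTree where
  | leaf : TernaryTree
  | node : TernaryTree → TernaryTree → TernaryTree → TernaryTree

namespace TernaryTree

/-- The number of leaves. -/
def leaves : TernaryTree → ℕ
  | leaf => 1
  | node x y z => x.leaves + y.leaves + z.leaves

theorem leaves_pos (t : TernaryTree) : 0 < t.leaves := by
  induction t with
  | leaf => exact Nat.one_pos
  | node x y z hx _ _ => simp only [leaves]; omega

/-- A lower bound for the length of a path between two corners of a subdivided triangle which avoids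
the third corner: at each inner node, two of the three parts can be traversed. -/
def pathLength : TernaryTree → ℕ
  | leaf => 1
  | node x y z => max (x.pathLength + y.pathLength)
      (max (x.pathLength + z.pathLength) (y.pathLength + z.pathLength))

theorem one_le_pathLength (t : TernaryTree) : 1 ≤ t.pathLength := by
  induction t with
  | leaf => exact le_rfl
  | node x y z hx _ _ => simp only [pathLength]; omega

/-- The trees obtained by replacing one leaf by a node with three leaves. -/
def expansions : TernaryTree → Multiset TernaryTree
  | leaf => {node leaf leaf leaf}
  | node x y z => x.expansions.map (node · y z) + y.expansions.map (node x · z) +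
      z.expansions.map (node x y ·)

theorem leaves_of_mem_expansions {t s : TernaryTree} (h : s ∈ t.expansions) :
    s.leaves = t.leaves + 2 := by
  induction t generalizing s with
  | leaf => rw [expansions, Multiset.mem_singleton] at h; subst h; rfl
  | node x y z hx hy hz =>
    simp only [expansions, Multiset.mem_add, Multiset.mem_map] at h
    rcases h with (⟨w, hw, rfl⟩ | ⟨w, hw, rfl⟩) | ⟨w, hw, rfl⟩
    · have := hx hw; simp only [leaves]; omega
    · have := hy hw; simp only [leaves]; omega
    · have := hz hw; simp only [leaves]; omega

end TernaryTree

/-! ### Concavity and the deterministic bound -/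

/-- With `S = x + 2 * y` and `t = 3 * y / S ≤ 1`, the point `x` divides the segment from `S` to `S /
3` in the same ratio `t` as `y` divides the one from `0` to `S / 3`. Since `(S / 3) ^ α = S ^ α /
2`, the two concavity inequalities add up to the claim. -/
theorem rpow_add_two_mul_le {α x y : ℝ} (h0 : 0 ≤ α) (h1 : α ≤ 1) (h3 : (3 : ℝ) ^ α = 2)
    (hy : 0 < y) (hyx : y ≤ x) : (x + 2 * y) ^ α ≤ x ^ α + y ^ α := by
  have hα : α ≠ 0 := by
    rintro rfl
    norm_num at h3
  have hS : 0 < x + 2 * y := by linarith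
  set S := x + 2 * y with hSdef
  have hc := Real.concaveOn_rpow h0 h1
  have ht : 0 ≤ 3 * y / S := by positivity
  have ht1 : 3 * y / S ≤ 1 := by rw [div_le_one hS]; linarith
  have e3 : (S / 3) ^ α = S ^ α / 2 := by rw [Real.div_rpow hS.le (by norm_num), h3]
  have hx' := hc.2 (x := S) (y := S / 3) (Set.mem_Ici.2 hS.le) (Set.mem_Ici.2 (by positivity))
    (sub_nonneg.2 ht1) ht (by ring)
  have hy' := hc.2 (x := 0) (y := S / 3) (Set.mem_Ici.2 le_rfl) (Set.mem_Ici.2 (by positivity))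
    (sub_nonneg.2 ht1) ht (by ring)
  simp only [smul_eq_mul] at hx' hy'
  have ex : (1 - 3 * y / S) * S + 3 * y / S * (S / 3) = x := by field_simp; rw [hSdef]; ring
  have ey : (1 - 3 * y / S) * 0 + 3 * y / S * (S / 3) = y := by field_simp; ring
  rw [ex, e3] at hx'
  rw [ey, e3, Real.zero_rpow hα] at hy'
  linarith

/-- Raising the smallest term `z` to the smaller of `x` and `y` only increases the left side. -/
theorem rpow_add_three_le {α x y z : ℝ} (h0 : 0 ≤ α) (h1 : α ≤ 1) (h3 : (3 : ℝ) ^ α = 2)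
    (hz : 0 < z) (hzx : z ≤ x) (hzy : z ≤ y) : (x + y + z) ^ α ≤ x ^ α + y ^ α := by
  rcases le_total x y with h | h
  · refine (Real.rpow_le_rpow (by linarith) (by linarith : x + y + z ≤ y + 2 * x) h0).trans ?_
    rw [add_comm (x ^ α)]
    exact rpow_add_two_mul_le h0 h1 h3 (hz.trans_le hzx) h
  · exact (Real.rpow_le_rpow (by linarith) (by linarith : x + y + z ≤ x + 2 * y) h0).trans
      (rpow_add_two_mul_le h0 h1 h3 (hz.trans_le hzy) h)

theorem three_rpow_log_two_div_log_three : (3 : ℝ) ^ (Real.log 2 / Real.log 3) = 2 := by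
  rw [Real.rpow_def_of_pos (by norm_num), mul_div_cancel₀ _ (Real.log_pos (by norm_num)).ne',
    Real.exp_log (by norm_num)]

theorem TernaryTree.rpow_leaves_le_pathLength (t : TernaryTree) :
    (t.leaves : ℝ) ^ (Real.log 2 / Real.log 3) ≤ t.pathLength := by
  have h0 : 0 ≤ Real.log 2 / Real.log 3 :=
    div_nonneg (Real.log_nonneg (by norm_num)) (Real.log_nonneg (by norm_num))
  have h1 : Real.log 2 / Real.log 3 ≤ 1 :=
    (div_le_one (Real.log_pos (by norm_num))).2 (Real.log_le_log (by norm_num) (by norm_num))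
  have h3 := three_rpow_log_two_div_log_three
  set α := Real.log 2 / Real.log 3
  induction t with
  | leaf => simp [leaves, pathLength]
  | node x y z hx hy hz =>
    have px : (0 : ℝ) < x.leaves := Nat.cast_pos.2 x.leaves_pos
    have py : (0 : ℝ) < y.leaves := Nat.cast_pos.2 y.leaves_pos
    have pz : (0 : ℝ) < z.leaves := Nat.cast_pos.2 z.leaves_pos
    simp only [leaves, pathLength]
    push_cast
    rcases le_total (x.leaves : ℝ) y.leaves with hxy | hxy
    · rcases le_total (x.leaves : ℝ) z.leaves with hxz | hxz
      · have := rpow_add_three_le h0 h1 h3 px hxy hxz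
        rw [show (y.leaves + z.leaves + x.leaves : ℝ) = x.leaves + y.leaves + z.leaves by ring]
          at this
        exact this.trans ((add_le_add hy hz).trans ((le_max_right _ _).trans (le_max_right _ _)))
      · exact (rpow_add_three_le h0 h1 h3 pz hxz (hxz.trans hxy)).trans
          ((add_le_add hx hy).trans (le_max_left _ _))
    · rcases le_total (y.leaves : ℝ) z.leaves with hyz | hyz
      · have := rpow_add_three_le h0 h1 h3 py hxy hyz
        rw [show (x.leaves + z.leaves + y.leaves : ℝ) = x.leaves + y.leaves + z.leaves by ring]
          at this
        exact this.trans ((add_le_add hx hz).trans ((le_max_left _ _).trans (le_max_right _ _)))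
      · exact (rpow_add_three_le h0 h1 h3 pz (hyz.trans hxy) hyz).trans
          ((add_le_add hx hy).trans (le_max_left _ _))

/-! ### Random trees and the urn of subtree sizes -/

namespace TernaryTree

/-- The sum of a function over all ways of expanding a leaf of a tree. -/
def growth : (TernaryTree → ℝ) →ₗ[ℝ] (TernaryTree → ℝ) where
  toFun φ t := (t.expansions.map φ).sum
  map_add' φ ψ := by ext t; exact Multiset.sum_map_add
  map_smul' r φ := by ext t; exact Multiset.sum_map_mul_left

theorem growth_apply (φ : TernaryTree → ℝ) (t : TernaryTree) :
    growth φ t = (t.expansions.map φ).sum := rfl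

theorem growth_mono {φ ψ : TernaryTree → ℝ} (h : φ ≤ ψ) : growth φ ≤ growth ψ := fun _ =>
  Multiset.sum_map_le_sum_map _ _ fun s _ => h s

/-- The number of ways to expand a leaf `k` times in succession. -/
noncomputable def histories (k : ℕ) : ℝ := ∏ j ∈ Finset.range k, (2 * (j : ℝ) + 1)

theorem histories_pos (k : ℕ) : 0 < histories k := Finset.prod_pos fun _ _ => by positivity

theorem histories_succ (k : ℕ) : histories (k + 1) = histories k * (2 * k + 1) :=
  Finset.prod_range_succ _ _

/-- The expectation of a function on the random tree obtained from a leaf by `k` expansions. -/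
noncomputable def mean (k : ℕ) : (TernaryTree → ℝ) →ₗ[ℝ] ℝ :=
  (histories k)⁻¹ • (LinearMap.proj leaf ∘ₗ (growth ^ k))

theorem mean_apply (k : ℕ) (φ : TernaryTree → ℝ) :
    mean k φ = (histories k)⁻¹ * (growth ^ k) φ leaf := rfl

theorem mean_zero (φ : TernaryTree → ℝ) : mean 0 φ = φ leaf := by
  simp [mean_apply, histories]

/-- After `k` expansions there are `2 * k + 1` leaves, so summing over the next expansion is
averaging times that number. -/
theorem mean_growth (k : ℕ) (φ : TernaryTree → ℝ) :
    mean k (growth φ) = (2 * k + 1) * mean (k + 1) φ := by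
  have := (histories_pos k).ne'
  have h : (2 * (k : ℝ) + 1) ≠ 0 := by positivity
  rw [mean_apply, mean_apply, histories_succ, pow_succ, Module.End.mul_apply]
  field_simp

theorem growth_pow_mono (k : ℕ) {φ ψ : TernaryTree → ℝ} (h : φ ≤ ψ) :
    (growth ^ k) φ ≤ (growth ^ k) ψ := by
  induction k with
  | zero => simpa using h
  | succ k ih =>
    rw [pow_succ', Module.End.mul_apply, Module.End.mul_apply]
    exact growth_mono ih

theorem mean_mono (k : ℕ) {φ ψ : TernaryTree → ℝ} (h : φ ≤ ψ) : mean k φ ≤ mean k ψ :=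
  mul_le_mul_of_nonneg_left (growth_pow_mono k h leaf) (inv_nonneg.2 (histories_pos k).le)

/-- Each expansion adds two leaves, so the number of choices increases by two every time. -/
theorem growth_pow_one (k : ℕ) (t : TernaryTree) :
    (growth ^ k) 1 t = ∏ j ∈ Finset.range k, (2 * (j : ℝ) + t.leaves) := by
  induction k generalizing t with
  | zero => simp
  | succ k ih =>
    have hcard (s : TernaryTree) : s.expansions.card = s.leaves := by
      induction s with
      | leaf => rfl
      | node x y z hx hy hz => simp [expansions, leaves, hx, hy, hz]
    rw [pow_succ', Module.End.mul_apply, growth_apply, Finset.prod_range_succ',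
      Multiset.map_congr rfl (g := fun _ => ∏ j ∈ Finset.range k,
        (2 * ((j + 1 : ℕ) : ℝ) + t.leaves))]
    · rw [Multiset.map_const', Multiset.sum_replicate, hcard, nsmul_eq_mul]
      push_cast
      ring
    · intro s hs
      rw [ih, leaves_of_mem_expansions hs]
      refine Finset.prod_congr rfl fun j _ => ?_
      push_cast
      ring

theorem mean_const (k : ℕ) (r : ℝ) : mean k (fun _ => r) = r := by
  have h : (fun _ : TernaryTree => r) = r • 1 := by ext; simp
  rw [h, map_smul, mean_apply, growth_pow_one]
  have : ∏ j ∈ Finset.range k, (2 * (j : ℝ) + (leaf.leaves : ℕ)) = histories k := by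
    simp [histories, leaves]
  rw [this, inv_mul_cancel₀ (histories_pos k).ne', smul_eq_mul, mul_one]

theorem mean_growth_comm (k : ℕ) (φ : TernaryTree → TernaryTree → ℝ) (t : TernaryTree) :
    mean k (fun s => growth (fun t' => φ t' s) t) = growth (fun t' => mean k (φ t')) t := by
  simp only [growth_apply]
  induction t.expansions using Multiset.induction with
  | empty => simpa using mean_const k 0
  | cons a s ih =>
    simp only [Multiset.map_cons, Multiset.sum_cons]
    rw [← ih]
    exact map_add (mean k) (φ a) _

/-- The sum of a function of three trees over all ways of expanding a leaf of one of them. -/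
def growthThree (φ : TernaryTree → TernaryTree → TernaryTree → ℝ) :
    TernaryTree → TernaryTree → TernaryTree → ℝ := fun x y z =>
  growth (fun x' => φ x' y z) x + growth (fun y' => φ x y' z) y + growth (fun z' => φ x y z') z

/-- The expectation of a function of three independent random trees of given sizes. -/
noncomputable def meanThree (φ : TernaryTree → TernaryTree → TernaryTree → ℝ) : ℕ → ℕ → ℕ → ℝ :=
  fun a b c => mean a fun x => mean b fun y => mean c fun z => φ x y z

/-- The generator of the three-colour urn in which the sizes of the three subtrees of the root
evolve. -/
def urn : (ℕ → ℕ → ℕ → ℝ) →ₗ[ℝ] (ℕ → ℕ → ℕ → ℝ) where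
  toFun χ a b c := (2 * a + 1) * χ (a + 1) b c + (2 * b + 1) * χ a (b + 1) c +
    (2 * c + 1) * χ a b (c + 1)
  map_add' χ χ' := by ext a b c; simp only [Pi.add_apply]; ring
  map_smul' r χ := by ext a b c; simp only [Pi.smul_apply, smul_eq_mul, RingHom.id_apply]; ring

theorem urn_apply (χ : ℕ → ℕ → ℕ → ℝ) (a b c : ℕ) :
    urn χ a b c = (2 * a + 1) * χ (a + 1) b c + (2 * b + 1) * χ a (b + 1) c +
      (2 * c + 1) * χ a b (c + 1) := rfl

theorem mean_add (k : ℕ) (φ ψ : TernaryTree → ℝ) :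
    mean k (fun t => φ t + ψ t) = mean k φ + mean k ψ := map_add (mean k) φ ψ

theorem mean_mul_left (k : ℕ) (r : ℝ) (φ : TernaryTree → ℝ) :
    mean k (fun t => r * φ t) = r * mean k φ := map_smul (mean k) r φ

/-- Averaging over three independent trees intertwines tree growth with the urn: only the sizes
matter for where the next expansion takes place. -/
theorem meanThree_growthThree (φ : TernaryTree → TernaryTree → TernaryTree → ℝ) :
    meanThree (growthThree φ) = urn (meanThree φ) := by
  ext a b c
  simp only [meanThree, growthThree, urn_apply, mean_add, mean_growth_comm, mean_growth,
    mean_mul_left]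

theorem growth_node (φ : TernaryTree → ℝ) (x y z : TernaryTree) :
    growth φ (node x y z) = growthThree (fun x y z => φ (node x y z)) x y z := by
  simp only [growth_apply, growthThree, expansions, Multiset.map_add, Multiset.sum_add,
    Multiset.map_map, Function.comp_def]

theorem meanThree_growth_pow (k : ℕ) (φ : TernaryTree → ℝ) :
    meanThree (fun x y z => (growth ^ k) φ (node x y z)) =
      (urn ^ k) (meanThree fun x y z => φ (node x y z)) := by
  induction k generalizing φ with
  | zero => rfl
  | succ k ih =>
    rw [pow_succ, pow_succ, Module.End.mul_apply, Module.End.mul_apply, ih,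
      ← meanThree_growthThree]
    simp only [growth_node]

/-- The first expansion is forced and creates the root; the other `k` are distributed over its three
subtrees by the urn. -/
theorem mean_succ (k : ℕ) (φ : TernaryTree → ℝ) :
    histories (k + 1) * mean (k + 1) φ =
      (urn ^ k) (meanThree fun x y z => φ (node x y z)) 0 0 0 := by
  rw [← meanThree_growth_pow, mean_apply, mul_inv_cancel_left₀ (histories_pos _).ne', pow_succ',
    Module.End.mul_apply]
  simp [meanThree, mean_zero, growth_apply, expansions]

end TernaryTree

/-! ### Law of the urn, its eigenfunctions and the smallest entry -/

namespace TernaryTree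

/-- One draw raises the level `a + b + c` by exactly one, so functions need to be compared on a
single level only. This lets level-dependent factors be treated as constants. -/
theorem urn_mono_of_level {n : ℕ} {χ χ' : ℕ → ℕ → ℕ → ℝ}
    (h : ∀ a b c, a + b + c = n + 1 → χ a b c ≤ χ' a b c) (a b c : ℕ) (habc : a + b + c = n) :
    urn χ a b c ≤ urn χ' a b c := by
  rw [urn_apply, urn_apply]
  have h1 := h (a + 1) b c (by omega)
  have h2 := h a (b + 1) c (by omega)
  have h3 := h a b (c + 1) (by omega)
  gcongr

theorem urn_pow_mono_of_level (k : ℕ) {n : ℕ} {χ χ' : ℕ → ℕ → ℕ → ℝ}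
    (h : ∀ a b c, a + b + c = n + k → χ a b c ≤ χ' a b c) (a b c : ℕ) (habc : a + b + c = n) :
    (urn ^ k) χ a b c ≤ (urn ^ k) χ' a b c := by
  induction k generalizing χ χ' with
  | zero => exact h a b c habc
  | succ k ih =>
    rw [pow_succ, Module.End.mul_apply, Module.End.mul_apply]
    exact ih (urn_mono_of_level h)

/-- The sum of `F a b c` over all `a + b + c = n`. -/
def sumThree {M : Type*} [AddCommMonoid M] (n : ℕ) (F : ℕ → ℕ → ℕ → M) : M :=
  ∑ p ∈ Finset.HasAntidiagonal.antidiagonal n, ∑ q ∈ Finset.HasAntidiagonal.antidiagonal p.2, F p.1 q.1 q.2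

theorem sumThree_congr {M : Type*} [AddCommMonoid M] {n : ℕ} {F G : ℕ → ℕ → ℕ → M}
    (h : ∀ a b c, a + b + c = n → F a b c = G a b c) : sumThree n F = sumThree n G := by
  refine Finset.sum_congr rfl fun p hp => Finset.sum_congr rfl fun q hq => h _ _ _ ?_
  rw [Finset.HasAntidiagonal.mem_antidiagonal] at hp hq
  omega

theorem sumThree_add {M : Type*} [AddCommMonoid M] (n : ℕ) (F G : ℕ → ℕ → ℕ → M) :
    sumThree n (fun a b c => F a b c + G a b c) = sumThree n F + sumThree n G := by
  simp only [sumThree, Finset.sum_add_distrib]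

theorem mul_sumThree (r : ℝ) (n : ℕ) (F : ℕ → ℕ → ℕ → ℝ) :
    r * sumThree n F = sumThree n fun a b c => r * F a b c := by
  simp only [sumThree, Finset.mul_sum]

theorem sumThree_succ_left {n : ℕ} {F : ℕ → ℕ → ℕ → ℝ} (h : ∀ b c, F 0 b c = 0) :
    sumThree (n + 1) F = sumThree n fun a b c => F (a + 1) b c := by
  simp [sumThree, Finset.Nat.sum_antidiagonal_succ, h]

theorem sumThree_succ_mid {n : ℕ} {F : ℕ → ℕ → ℕ → ℝ} (h : ∀ a c, F a 0 c = 0) :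
    sumThree (n + 1) F = sumThree n fun a b c => F a (b + 1) c := by
  simp [sumThree, Finset.Nat.sum_antidiagonal_succ', Finset.Nat.sum_antidiagonal_succ
    (f := fun q : ℕ × ℕ => F _ q.1 q.2), h]

theorem sumThree_succ_right {n : ℕ} {F : ℕ → ℕ → ℕ → ℝ} (h : ∀ a b, F a b 0 = 0) :
    sumThree (n + 1) F = sumThree n fun a b c => F a b (c + 1) := by
  simp [sumThree, Finset.Nat.sum_antidiagonal_succ', h]

/-- The weight of `k` draws of the same colour from the urn. -/
noncomputable def urnWeight (k : ℕ) : ℝ := k.centralBinom / 2 ^ k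

theorem urnWeight_succ (k : ℕ) :
    ((k + 1 : ℕ) : ℝ) * urnWeight (k + 1) = (2 * k + 1) * urnWeight k := by
  have h : ((k : ℝ) + 1) * (k + 1).centralBinom = 2 * (2 * k + 1) * k.centralBinom := by
    exact_mod_cast k.succ_mul_centralBinom_succ
  rw [urnWeight, urnWeight, pow_succ]
  field_simp
  push_cast
  linear_combination h

/-- A colour drawn `a` times contributes `1 * 3 * ⋯ * (2 * a - 1)`, and the orders of the draws are
counted by a multinomial coefficient; dividing the former by `a!` gives `urnWeight a`. -/
theorem urn_pow_eq_sumThree (k : ℕ) (χ : ℕ → ℕ → ℕ → ℝ) :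
    (urn ^ k) χ 0 0 0 = k.factorial *
      sumThree k fun a b c => urnWeight a * urnWeight b * urnWeight c * χ a b c := by
  induction k generalizing χ with
  | zero => simp [sumThree, urnWeight]
  | succ k ih =>
    rw [pow_succ, Module.End.mul_apply, ih, Nat.factorial_succ]
    push_cast
    rw [mul_comm ((k : ℝ) + 1), mul_assoc]
    congr 1
    -- Split the factor `k + 1 = a + b + c`. Each part vanishes when its own index is zero, so that
    -- index can be shifted down by one.
    have e : ((k : ℝ) + 1) * sumThree (k + 1) (fun a b c =>
        urnWeight a * urnWeight b * urnWeight c * χ a b c) =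
        sumThree (k + 1) (fun a b c => a * urnWeight a * urnWeight b * urnWeight c * χ a b c) +
        sumThree (k + 1) (fun a b c => b * urnWeight b * urnWeight a * urnWeight c * χ a b c) +
        sumThree (k + 1) fun a b c => c * urnWeight c * urnWeight a * urnWeight b * χ a b c := by
      rw [← sumThree_add, ← sumThree_add, mul_sumThree]
      refine sumThree_congr fun a b c h => ?_
      have : (k : ℝ) + 1 = a + b + c := by exact_mod_cast h.symm
      rw [this]
      ring
    rw [e, sumThree_succ_left (by simp), sumThree_succ_mid (by simp),
      sumThree_succ_right (by simp), ← sumThree_add, ← sumThree_add]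
    simp only [urnWeight_succ, urn_apply]
    refine sumThree_congr fun a b c _ => ?_
    ring

/-- A function which the urn multiplies by a constant on each level; it grows like `k ^ 0.88`. -/
noncomputable def potential (k : ℕ) : ℝ :=
  ∏ j ∈ Finset.range k, (2 * (j : ℝ) + 2.76) / (2 * j + 1)

theorem potential_pos (k : ℕ) : 0 < potential k := Finset.prod_pos fun _ _ => by positivity

theorem potential_succ (k : ℕ) :
    potential (k + 1) = potential k * ((2 * k + 2.76) / (2 * k + 1)) :=
  Finset.prod_range_succ _ _

theorem mul_potential_succ (k : ℕ) :
    (2 * (k : ℝ) + 1) * potential (k + 1) = (2 * k + 2.76) * potential k := by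
  rw [potential_succ]
  field_simp

theorem potential_monotone : Monotone potential := monotone_nat_of_le_succ fun k => by
  rw [potential_succ]
  refine le_mul_of_one_le_right (potential_pos k).le ?_
  rw [one_le_div (by positivity)]
  linarith

/-- Each factor of `potential` is `1 + 0.88 * (2 / (2 * j + 1))`, so Bernoulli's inequality for
exponents below one applies; this is where `2.76 = 1 + 2 * 0.88` comes from. -/
theorem rpow_le_potential (k : ℕ) : (2 * (k : ℝ) + 1) ^ (0.88 : ℝ) ≤ potential k := by
  induction k with
  | zero => simp [potential]
  | succ k ih =>
    have hk : (0 : ℝ) < 2 * k + 1 := by positivity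
    have hq : 0 < 2 / (2 * (k : ℝ) + 1) := by positivity
    have hb : (1 + 2 / (2 * (k : ℝ) + 1)) ^ (0.88 : ℝ) ≤ 1 + 0.88 * (2 / (2 * (k : ℝ) + 1)) :=
      rpow_one_add_le_one_add_mul_self (by linarith) (by norm_num) (by norm_num)
    have e : 2 * ((k + 1 : ℕ) : ℝ) + 1 = (2 * k + 1) * (1 + 2 / (2 * (k : ℝ) + 1)) := by
      field_simp
      push_cast
      ring
    rw [e, Real.mul_rpow hk.le (by positivity), potential_succ]
    refine mul_le_mul ih (hb.trans_eq ?_) (by positivity) (potential_pos k).le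
    field_simp
    ring

/-- The growth of the potential of the urn. -/
noncomputable def potentialGrowth (k : ℕ) : ℝ := ∏ j ∈ Finset.range k, (2 * (j : ℝ) + 4.76)

theorem potentialGrowth_succ (k : ℕ) :
    potentialGrowth (k + 1) = potentialGrowth k * (2 * k + 4.76) := Finset.prod_range_succ _ _

theorem histories_succ_mul_potential (k : ℕ) :
    histories (k + 1) * potential (k + 1) = 2.76 * potentialGrowth k := by
  induction k with
  | zero => simp [histories, potential, potentialGrowth]
  | succ k ih =>
    rw [histories_succ, potential_succ, potentialGrowth_succ]
    have : (2 * ((k + 1 : ℕ) : ℝ) + 1) ≠ 0 := by positivity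
    field_simp
    rw [ih]
    push_cast
    ring

/-- The eigenvalue depends only on the level, which is known after each number of draws. For
`potential` of one coordinate it is `(2 * a + 2.76) + (2 * b + 1) + (2 * c + 1)`. -/
theorem urn_pow_of_level_eq {χ : ℕ → ℕ → ℕ → ℝ}
    (h : ∀ a b c, urn χ a b c = (2 * ((a + b + c : ℕ) : ℝ) + 4.76) * χ a b c) (k : ℕ) :
    (urn ^ k) χ 0 0 0 = potentialGrowth k * χ 0 0 0 := by
  suffices H : ∀ a b c, a + b + c = 0 → (urn ^ k) χ a b c = potentialGrowth k * χ a b c from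
    H 0 0 0 rfl
  induction k with
  | zero => simp [potentialGrowth]
  | succ k ih =>
    intro a b c habc
    have h1 : (urn ^ (k + 1)) χ a b c = (urn ^ k) ((2 * (k : ℝ) + 4.76) • χ) a b c := by
      rw [pow_succ, Module.End.mul_apply]
      refine le_antisymm (urn_pow_mono_of_level k (n := 0) ?_ a b c habc)
        (urn_pow_mono_of_level k (n := 0) ?_ a b c habc) <;>
      · intro a b c hk
        rw [h, hk, zero_add]
        exact le_rfl
    rw [h1, map_smul, potentialGrowth_succ]
    simp only [Pi.smul_apply, smul_eq_mul]
    rw [ih a b c habc]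
    ring

/-- The potential of the smallest entry. -/
noncomputable def minPotential (a b c : ℕ) : ℝ := potential (min a (min b c))

/-- A draw raises the minimum only if it hits a unique smallest entry, and then equality holds by
the recursion of `potential`. If the minimum is attained twice, no draw raises it and the factor is
only `2 * (a + b + c) + 3`. -/
theorem urn_minPotential_le (a b c : ℕ) :
    urn minPotential a b c ≤ (2 * ((a + b + c : ℕ) : ℝ) + 4.76) * minPotential a b c := by
  have key (x y z m : ℕ) (hx : min (x + 1) (min y z) = m ∨ x = m ∧ min (x + 1) (min y z) = m + 1)
      (hy : min x (min (y + 1) z) = m ∨ y = m ∧ min x (min (y + 1) z) = m + 1)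
      (hz : min x (min y (z + 1)) = m ∨ z = m ∧ min x (min y (z + 1)) = m + 1)
      (hm : min x (min y z) = m) :
      urn minPotential x y z ≤ (2 * ((x + y + z : ℕ) : ℝ) + 4.76) * minPotential x y z := by
    have hp := potential_pos m
    have hs := mul_potential_succ m
    rw [urn_apply]
    simp only [minPotential, hm]
    push_cast
    rcases hx with hx | ⟨rfl, hx⟩
    · rcases hy with hy | ⟨rfl, hy⟩
      · rcases hz with hz | ⟨rfl, hz⟩
        · rw [hx, hy, hz]; nlinarith
        · rw [hx, hy, hz, hs]; linarith
      · rcases hz with hz | ⟨rfl, hz⟩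
        · rw [hx, hy, hz, hs]; linarith
        · omega
    · rcases hy with hy | ⟨rfl, hy⟩
      · rcases hz with hz | ⟨rfl, hz⟩
        · rw [hx, hy, hz, hs]; linarith
        · omega
      · omega
  exact key a b c _ (by omega) (by omega) (by omega) rfl

theorem urn_pow_minPotential_succ_le (k : ℕ) :
    (urn ^ (k + 1)) minPotential 0 0 0 ≤
      (2 * k + 4.76) * (urn ^ k) minPotential 0 0 0 := by
  have h : (urn ^ k) (urn minPotential) 0 0 0 ≤
      (urn ^ k) ((2 * (k : ℝ) + 4.76) • minPotential) 0 0 0 := by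
    refine urn_pow_mono_of_level k (n := 0) (fun a b c hk => ?_) 0 0 0 rfl
    refine (urn_minPotential_le a b c).trans_eq ?_
    rw [hk, zero_add]
    rfl
  rw [map_smul] at h
  rwa [pow_succ, Module.End.mul_apply]

end TernaryTree

/-! ### Numerical certificate at 80 draws -/

namespace TernaryTree

/-- The central binomial coefficients, in a form that evaluates quickly. -/
def binomTable (k : ℕ) : ℕ := k.rec 1 fun j r => r * (2 * (2 * j + 1)) / (j + 1)

/-- Upper bounds for the values of `10 ^ 6 * potential`. -/
def potentialTable (k : ℕ) : ℕ :=
  k.rec (10 ^ 6) fun j r => r * (50 * j + 69) / (50 * j + 25) + 1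

/-- The sum of the first `n` values of a sequence. -/
def sumTable (f : ℕ → ℕ) (n : ℕ) : ℕ := n.rec 0 fun j r => r + f j

/-- The value of `25 ^ n * potentialGrowth n`. -/
def growthTable (n : ℕ) : ℕ := n.rec 1 fun j r => r * (50 * j + 119)

/-- An upper bound for the total potential of the smallest entry after `n` draws, up to scaling. -/
def minTable (n : ℕ) : ℕ :=
  sumTable (fun a => binomTable a * sumTable (fun b => binomTable b *
    (binomTable (n - a - b) * potentialTable (min a (min b (n - a - b))))) (n - a + 1)) (n + 1)

theorem binomTable_eq (k : ℕ) : binomTable k = k.centralBinom := by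
  induction k with
  | zero => rfl
  | succ k ih =>
    change binomTable k * (2 * (2 * k + 1)) / (k + 1) = _
    rw [ih, mul_comm, ← k.succ_mul_centralBinom_succ, Nat.mul_div_cancel_left _ k.succ_pos]

theorem potential_le_potentialTable (k : ℕ) : 10 ^ 6 * potential k ≤ potentialTable k := by
  induction k with
  | zero => norm_num [potential, potentialTable]
  | succ k ih =>
    -- The ratio `(2 * k + 2.76) / (2 * k + 1)` is `(50 * k + 69) / (50 * k + 25)`; adding one after
    -- the floor division keeps the table an upper bound.
    have h := Nat.lt_div_mul_add (a := potentialTable k * (50 * k + 69)) (b := 50 * k + 25)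
      (by positivity)
    have h' : potentialTable (k + 1) =
      potentialTable k * (50 * k + 69) / (50 * k + 25) + 1 := rfl
    have h1 : potentialTable k * (50 * k + 69) ≤ potentialTable (k + 1) * (50 * k + 25) := by
      rw [h', add_mul, one_mul]
      exact h.le
    have h2 : (potentialTable k : ℝ) * (50 * k + 69) ≤
        potentialTable (k + 1) * (50 * k + 25) := by exact_mod_cast h1
    have h3 : (0 : ℝ) < 50 * k + 25 := by positivity
    refine le_of_mul_le_mul_right ?_ h3
    refine le_trans (le_of_eq ?_) ((mul_le_mul_of_nonneg_right ih
      (by positivity : (0 : ℝ) ≤ 50 * k + 69)).trans h2)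
    rw [potential_succ]
    field_simp
    ring

theorem sumTable_eq (f : ℕ → ℕ) (n : ℕ) : sumTable f n = ∑ j ∈ Finset.range n, f j := by
  induction n with
  | zero => rfl
  | succ n ih => rw [Finset.sum_range_succ, ← ih]; rfl

theorem growthTable_eq (n : ℕ) : (growthTable n : ℝ) = 25 ^ n * potentialGrowth n := by
  induction n with
  | zero => simp [growthTable, potentialGrowth]
  | succ n ih =>
    change ((growthTable n * (50 * n + 119) : ℕ) : ℝ) = _
    push_cast
    rw [ih, potentialGrowth_succ, pow_succ]
    ring

theorem minTable_eq (n : ℕ) : minTable n = sumThree n fun a b c =>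
    a.centralBinom * (b.centralBinom * (c.centralBinom * potentialTable (min a (min b c)))) := by
  simp only [minTable, sumTable_eq, binomTable_eq, sumThree, ← Finset.mul_sum,
    Finset.Nat.sum_antidiagonal_eq_sum_range_succ_mk, Nat.succ_eq_add_one]

theorem urn_pow_minPotential_le (n : ℕ) :
    10 ^ 6 * 2 ^ n * (urn ^ n) minPotential 0 0 0 ≤ n.factorial * minTable n := by
  rw [urn_pow_eq_sumThree, minTable_eq, mul_left_comm]
  refine mul_le_mul_of_nonneg_left ?_ (Nat.cast_nonneg _)
  rw [mul_sumThree]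
  simp only [sumThree]
  push_cast
  refine Finset.sum_le_sum fun p hp => Finset.sum_le_sum fun q hq => ?_
  rw [Finset.HasAntidiagonal.mem_antidiagonal] at hp hq
  have h := potential_le_potentialTable (min p.1 (min q.1 q.2))
  have e : (2 : ℝ) ^ n = 2 ^ p.1 * 2 ^ q.1 * 2 ^ q.2 := by
    rw [← pow_add, ← pow_add, ← hp, ← hq, add_assoc]
  calc _ = (p.1.centralBinom : ℝ) * (q.1.centralBinom * (q.2.centralBinom *
        (10 ^ 6 * potential (min p.1 (min q.1 q.2))))) := by
        rw [e, minPotential, urnWeight, urnWeight, urnWeight]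
        field_simp
    _ ≤ _ := by gcongr

/-- After clearing denominators this bounds the cost of the smallest entry by `0.24 = 6 / 25` times
`potentialGrowth 80`: the factors `10 ^ 6` and `2 ^ 80` come from `potentialTable` and `urnWeight`,
and `25 ^ 80` from `growthTable`. -/
theorem minTable_eighty : Nat.factorial 80 * minTable 80 * 25 * 25 ^ 80 ≤
    6 * 10 ^ 6 * 2 ^ 80 * growthTable 80 := by
  decide +kernel

theorem urn_pow_minPotential_le_of_eighty_le {k : ℕ} (hk : 80 ≤ k) :
    (urn ^ k) minPotential 0 0 0 ≤ 0.24 * potentialGrowth k := by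
  induction k, hk using Nat.le_induction with
  | base =>
    have h1 := urn_pow_minPotential_le 80
    have h2 : ((Nat.factorial 80 * minTable 80 * 25 * 25 ^ 80 : ℕ) : ℝ) ≤
        (6 * 10 ^ 6 * 2 ^ 80 * growthTable 80 : ℕ) := Nat.cast_le.2 minTable_eighty
    push_cast [growthTable_eq] at h2
    generalize (urn ^ 80) minPotential 0 0 0 = u at *
    generalize ((Nat.factorial 80 : ℕ) : ℝ) * (minTable 80 : ℝ) = v at *
    generalize potentialGrowth 80 = w at *
    linarith
  | succ k hk ih =>
    rw [potentialGrowth_succ]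
    refine (urn_pow_minPotential_succ_le k).trans ?_
    refine (mul_le_mul_of_nonneg_left ih (by positivity)).trans_eq ?_
    ring

/-! ### Recursion for the mean path length -/

/-- The expected value of `pathLength` after `k` expansions. -/
noncomputable def meanPathLength (k : ℕ) : ℝ := mean k fun t => t.pathLength

theorem one_le_meanPathLength (k : ℕ) : 1 ≤ meanPathLength k := by
  rw [← mean_const k 1]
  exact mean_mono k fun t => Nat.one_le_cast.2 t.one_le_pathLength

/-- The pair of subtrees is chosen by size alone, leaving out the smallest; the maximum over pairs
dominates this fixed choice. -/
theorem meanThree_pathLength_ge (a b c : ℕ) :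
    meanPathLength a + meanPathLength b + meanPathLength c - meanPathLength (min a (min b c)) ≤
      meanThree (fun x y z => ((node x y z).pathLength : ℝ)) a b c := by
  have h1 : mean a (fun x => mean b fun y => mean c fun _ => (x.pathLength + y.pathLength : ℝ)) ≤
      meanThree (fun x y z => ((node x y z).pathLength : ℝ)) a b c :=
    mean_mono a fun x => mean_mono b fun y => mean_mono c fun z => by
      beta_reduce
      rw [← Nat.cast_add]
      exact Nat.cast_le.2 (le_max_left _ _)
  have h2 : mean a (fun x => mean b fun _ => mean c fun z => (x.pathLength + z.pathLength : ℝ)) ≤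
      meanThree (fun x y z => ((node x y z).pathLength : ℝ)) a b c :=
    mean_mono a fun x => mean_mono b fun y => mean_mono c fun z => by
      beta_reduce
      rw [← Nat.cast_add]
      exact Nat.cast_le.2 ((le_max_left _ _).trans (le_max_right _ _))
  have h3 : mean a (fun _ => mean b fun y => mean c fun z => (y.pathLength + z.pathLength : ℝ)) ≤
      meanThree (fun x y z => ((node x y z).pathLength : ℝ)) a b c :=
    mean_mono a fun x => mean_mono b fun y => mean_mono c fun z => by
      beta_reduce
      rw [← Nat.cast_add]
      exact Nat.cast_le.2 ((le_max_right _ _).trans (le_max_right _ _))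
  simp only [mean_add, mean_const] at h1 h2 h3
  simp only [meanPathLength]
  rcases min_choice a (min b c) with h | h <;> rw [h]
  · linarith
  · rcases min_choice b c with h | h <;> rw [h] <;> linarith

theorem urn_pow_potential_left (k : ℕ) :
    (urn ^ k) (fun a _ _ => potential a) 0 0 0 = potentialGrowth k := by
  rw [urn_pow_of_level_eq (fun a b c => ?_) k]
  · simp [potential]
  · rw [urn_apply]
    push_cast
    linear_combination mul_potential_succ a

theorem urn_pow_potential_mid (k : ℕ) :
    (urn ^ k) (fun _ b _ => potential b) 0 0 0 = potentialGrowth k := by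
  rw [urn_pow_of_level_eq (fun a b c => ?_) k]
  · simp [potential]
  · rw [urn_apply]
    push_cast
    linear_combination mul_potential_succ b

theorem urn_pow_potential_right (k : ℕ) :
    (urn ^ k) (fun _ _ c => potential c) 0 0 0 = potentialGrowth k := by
  rw [urn_pow_of_level_eq (fun a b c => ?_) k]
  · simp [potential]
  · rw [urn_apply]
    push_cast
    linear_combination mul_potential_succ c

theorem potential_le_meanPathLength (k : ℕ) :
    (potential 80)⁻¹ * potential k ≤ meanPathLength k := by
  have hpos := potential_pos 80
  induction k using Nat.strong_induction_on with
  | h k ih =>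
    rcases le_or_gt k 80 with hk | hk
    -- The constant is normalised so that up to `80` the trivial bound `1` suffices.
    · refine le_trans ?_ (one_le_meanPathLength k)
      rw [inv_mul_le_one₀ hpos]
      exact potential_monotone hk
    · obtain ⟨k, rfl⟩ : ∃ j, k = j + 1 := ⟨k - 1, by omega⟩
      have hmin := urn_pow_minPotential_le_of_eighty_le (k := k) (by omega)
      set r := (potential 80)⁻¹
      have hr : 0 ≤ r := (inv_pos.2 hpos).le
      have key : (urn ^ k) (r • ((fun a _ _ => potential a) + (fun _ b _ => potential b) +
          (fun _ _ c => potential c) - minPotential)) 0 0 0 ≤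
          (urn ^ k) (meanThree fun x y z => ((node x y z).pathLength : ℝ)) 0 0 0 := by
        refine urn_pow_mono_of_level k (n := 0) (fun a b c h => ?_) 0 0 0 rfl
        refine le_trans ?_ (meanThree_pathLength_ge a b c)
        have ha := ih a (by omega)
        have hb := ih b (by omega)
        have hc := ih c (by omega)
        simp only [Pi.smul_apply, Pi.add_apply, Pi.sub_apply, smul_eq_mul, minPotential]
        -- The subtracted term cancels one of the three, so the induction hypothesis is needed only
        -- as a lower bound for the two that remain.
        rcases min_choice a (min b c) with h | h <;> rw [h]
        · linarith
        · rcases min_choice b c with h | h <;> rw [h] <;> linarith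
      rw [map_smul, map_sub, map_add, map_add] at key
      simp only [Pi.smul_apply, Pi.add_apply, Pi.sub_apply, smul_eq_mul, urn_pow_potential_left,
        urn_pow_potential_mid, urn_pow_potential_right] at key
      rw [← mean_succ k fun t => (t.pathLength : ℝ)] at key
      refine le_of_mul_le_mul_left (le_trans ?_ key) (histories_pos (k + 1))
      -- The induction closes because `2.76 = 3 - 0.24`.
      rw [mul_left_comm, histories_succ_mul_potential]
      refine mul_le_mul_of_nonneg_left ?_ hr
      linarith

theorem rpow_le_meanPathLength (k : ℕ) :
    (potential 80)⁻¹ * (2 * (k : ℝ) + 1) ^ (0.88 : ℝ) ≤ meanPathLength k :=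
  (mul_le_mul_of_nonneg_left (rpow_le_potential k) (inv_pos.2 (potential_pos 80)).le).trans
    (potential_le_meanPathLength k)

end TernaryTree

/-! ### Concatenating paths through subdivided triangles -/

/-- There is a path from `x` to `y` with at least `l` edges whose inner vertices lie in `S`. -/
def SimpleGraph.HasLongPath (G : SimpleGraph ℕ) (S : Set ℕ) (x y l : ℕ) : Prop :=
  ∃ p : G.Walk x y, p.IsPath ∧ l ≤ p.length ∧ ∀ w ∈ p.support, w = x ∨ w = y ∨ w ∈ S

namespace SimpleGraph.HasLongPath

variable {G : SimpleGraph ℕ}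

theorem symm {S : Set ℕ} {x y l : ℕ} (h : G.HasLongPath S x y l) : G.HasLongPath S y x l := by
  obtain ⟨p, hp, hl, hS⟩ := h
  refine ⟨p.reverse, hp.reverse, by rwa [Walk.length_reverse], fun w hw => ?_⟩
  rw [Walk.support_reverse, List.mem_reverse] at hw
  rcases hS w hw with h | h | h <;> simp [h]

/-- Disjoint interiors, together with the conditions on the endpoints, make `v` the only common
vertex, so the concatenation stays simple. -/
theorem trans {S T U : Set ℕ} {x y v l l' : ℕ} (h : G.HasLongPath S x v l)
    (h' : G.HasLongPath T v y l') (hST : Disjoint S T) (hvS : v ∉ S) (hyS : y ∉ S)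
    (hxT : x ∉ T) (hxy : x ≠ y) (hxv : x ≠ v) (hSU : S ⊆ U) (hTU : T ⊆ U) (hvU : v ∈ U) :
    G.HasLongPath U x y (l + l') := by
  obtain ⟨p, hp, hl, hS⟩ := h
  obtain ⟨q, hq, hl', hT⟩ := h'
  refine ⟨p.append q, ?_, by rw [Walk.length_append]; omega, fun w hw => ?_⟩
  · rw [Walk.isPath_def, Walk.support_append, List.nodup_append]
    have hqn := hq.support_nodup
    rw [← Walk.cons_tail_support, List.nodup_cons] at hqn
    refine ⟨hp.support_nodup, hqn.2, fun w hw w' hw' => ?_⟩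
    rintro rfl
    have hwv : w ≠ v := fun e => hqn.1 (e ▸ hw')
    rcases hT w (List.mem_of_mem_tail hw') with rfl | rfl | h1
    · exact hwv rfl
    · rcases hS w hw with rfl | rfl | h2
      exacts [hxy rfl, hwv rfl, hyS h2]
    · rcases hS w hw with rfl | rfl | h2
      exacts [hxT h1, hwv rfl, hST.notMem_of_mem_left h2 h1]
  · rw [Walk.mem_support_append_iff] at hw
    rcases hw with hw | hw
    · rcases hS w hw with rfl | rfl | h1
      exacts [Or.inl rfl, Or.inr (Or.inr hvU), Or.inr (Or.inr (hSU h1))]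
    · rcases hT w hw with rfl | rfl | h1
      exacts [Or.inr (Or.inr hvU), Or.inr (Or.inl rfl), Or.inr (Or.inr (hTU h1))]

theorem mono_length {S : Set ℕ} {x y l l' : ℕ} (h : G.HasLongPath S x y l) (hl : l' ≤ l) :
    G.HasLongPath S x y l' := by
  obtain ⟨p, hp, hpl, hS⟩ := h
  exact ⟨p, hp, hl.trans hpl, hS⟩

/-- Two corners `x`, `y` of a triangle which is divided into three parts by an inner vertex `v` are
joined by a path through any two of the three parts. Here `X` is the part at `y`, `Y` the part at
`x`, and `Z` the part at both. -/
theorem of_three {X Y Z U : Set ℕ} {x y v i j k : ℕ} (hX : G.HasLongPath X v y i)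
    (hY : G.HasLongPath Y x v j) (hZ : G.HasLongPath Z x v k) (hZ' : G.HasLongPath Z v y k)
    (hXY : Disjoint X Y) (hXZ : Disjoint X Z) (hYZ : Disjoint Y Z) (hx : x ∉ U) (hy : y ∉ U)
    (hxy : x ≠ y) (hXU : X ⊆ U) (hYU : Y ⊆ U) (hZU : Z ⊆ U) (hvU : v ∈ U) (hvY : v ∉ Y)
    (hvZ : v ∉ Z) {l : ℕ} (hl : l ≤ i + j ∨ l ≤ i + k ∨ l ≤ j + k) : G.HasLongPath U x y l := by
  have hxv : x ≠ v := fun e => hx (e ▸ hvU)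
  rcases hl with hl | hl | hl
  · exact (hY.trans hX hXY.symm hvY (fun h => hy (hYU h)) (fun h => hx (hXU h)) hxy hxv hYU hXU
      hvU).mono_length (by omega)
  · exact (hZ.trans hX hXZ.symm hvZ (fun h => hy (hZU h)) (fun h => hx (hXU h)) hxy hxv hZU hXU
      hvU).mono_length (by omega)
  · exact (hY.trans hZ' hYZ hvY (fun h => hy (hYU h)) (fun h => hx (hZU h)) hxy hxv hYU hZU
      hvU).mono_length (by omega)

end SimpleGraph.HasLongPath

/-! ### Trees describing subdivided triangles -/

namespace TernaryTree

/-- `t.Represents a b c V F`: the tree `t` describes repeated subdivisions of the triangle with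
corners `a`, `b`, `c`, where `V` are the new vertices and `F` the faces. -/
inductive Represents : TernaryTree → ℕ → ℕ → ℕ → Multiset ℕ → Multiset (Finset ℕ) → Prop
  | leaf (a b c : ℕ) : Represents leaf a b c 0 {{a, b, c}}
  | node {x y z : TernaryTree} {a b c v : ℕ} {V₁ V₂ V₃ : Multiset ℕ}
      {F₁ F₂ F₃ : Multiset (Finset ℕ)} : Represents x v b c V₁ F₁ → Represents y a v c V₂ F₂ →
      Represents z a b v V₃ F₃ →
      Represents (node x y z) a b c (v ::ₘ (V₁ + V₂ + V₃)) (F₁ + F₂ + F₃)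

theorem Represents.card_faces {t : TernaryTree} {a b c : ℕ} {V : Multiset ℕ}
    {F : Multiset (Finset ℕ)} (h : t.Represents a b c V F) : F.card = t.leaves := by
  induction h with
  | leaf => rfl
  | node _ _ _ hx hy hz => rw [Multiset.card_add, Multiset.card_add, hx, hy, hz]; rfl

/-- All three pairs of corners must be treated together, since the induction uses different pairs in
different parts. Inner vertices confined to `V` keep each path away from the third corner, which is
what allows joining at `v`. -/
theorem Represents.hasLongPath {G : SimpleGraph ℕ} {t : TernaryTree} {a b c : ℕ}
    {V : Multiset ℕ} {F : Multiset (Finset ℕ)} (h : t.Represents a b c V F)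
    (hV : (a ::ₘ b ::ₘ c ::ₘ V).Nodup) (hF : ∀ f ∈ F, G.IsClique (f : Set ℕ)) :
    G.HasLongPath {w | w ∈ V} a b t.pathLength ∧ G.HasLongPath {w | w ∈ V} a c t.pathLength ∧
      G.HasLongPath {w | w ∈ V} b c t.pathLength := by
  induction h with
  | leaf a b c =>
    have hc := hF _ (Multiset.mem_singleton_self _)
    simp only [Multiset.nodup_cons, Multiset.mem_cons, not_or] at hV
    have key {x y : ℕ} (hx : x ∈ ({a, b, c} : Finset ℕ)) (hy : y ∈ ({a, b, c} : Finset ℕ))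
        (hxy : x ≠ y) : G.HasLongPath {w | w ∈ (0 : Multiset ℕ)} x y TernaryTree.leaf.pathLength :=
      ⟨(hc hx hy hxy).toWalk, by simp [hxy], by simp [pathLength], by simp⟩
    exact ⟨key (by simp) (by simp) hV.1.1, key (by simp) (by simp) hV.1.2.1,
      key (by simp) (by simp) hV.2.1.1⟩
  | @node x y z a b c v V₁ V₂ V₃ F₁ F₂ F₃ _ _ _ hx hy hz =>
    simp only [Multiset.nodup_cons, Multiset.mem_cons, Multiset.mem_add, Multiset.nodup_add,
      not_or] at hV hx hy hz
    obtain ⟨⟨hab, hac, hav, ⟨ha1, ha2⟩, ha3⟩, ⟨hbc, hbv, ⟨hb1, hb2⟩, hb3⟩,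
      ⟨hcv, ⟨hc1, hc2⟩, hc3⟩, ⟨⟨hv1, hv2⟩, hv3⟩, ⟨n1, n2, d12⟩, n3, d3⟩ := hV
    obtain ⟨d13, d23⟩ := Multiset.disjoint_add_left.1 d3
    obtain ⟨xvb, xvc, xbc⟩ := hx ⟨⟨Ne.symm hbv, Ne.symm hcv, hv1⟩, ⟨hbc, hb1⟩, hc1, n1⟩
      fun f hf => hF f (by simp [hf])
    obtain ⟨yav, yac, yvc⟩ := hy ⟨⟨hav, hac, ha2⟩, ⟨Ne.symm hcv, hv2⟩, hc2, n2⟩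
      fun f hf => hF f (by simp [hf])
    obtain ⟨zab, zav, zbv⟩ := hz ⟨⟨hab, hav, ha3⟩, ⟨hbv, hb3⟩, hv3, n3⟩
      fun f hf => hF f (by simp [hf])
    have toSet {A B : Multiset ℕ} (h : Disjoint A B) : Disjoint {w | w ∈ A} {w | w ∈ B} :=
      Set.disjoint_left.2 fun w hw hw' => Multiset.disjoint_left.1 h hw hw'
    have D12 := toSet d12
    have D13 := toSet d13
    have D23 := toSet d23
    have s1 : {w | w ∈ V₁} ⊆ {w | w ∈ v ::ₘ (V₁ + V₂ + V₃)} := fun w (hw : w ∈ V₁) => by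
      simp [hw]
    have s2 : {w | w ∈ V₂} ⊆ {w | w ∈ v ::ₘ (V₁ + V₂ + V₃)} := fun w (hw : w ∈ V₂) => by
      simp [hw]
    have s3 : {w | w ∈ V₃} ⊆ {w | w ∈ v ::ₘ (V₁ + V₂ + V₃)} := fun w (hw : w ∈ V₃) => by
      simp [hw]
    have hv : v ∈ {w | w ∈ v ::ₘ (V₁ + V₂ + V₃)} := by simp
    have ha : a ∉ {w | w ∈ v ::ₘ (V₁ + V₂ + V₃)} := by simp [hav, ha1, ha2, ha3]
    have hb : b ∉ {w | w ∈ v ::ₘ (V₁ + V₂ + V₃)} := by simp [hbv, hb1, hb2, hb3]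
    have hc : c ∉ {w | w ∈ v ::ₘ (V₁ + V₂ + V₃)} := by simp [hcv, hc1, hc2, hc3]
    exact ⟨.of_three xvb yav zav zbv.symm D12 D13 D23 ha hb hab s1 s2 s3 hv hv2 hv3
        (by simp only [pathLength]; omega),
      .of_three xvc zav yav yvc D13 D12 D23.symm ha hc hac s1 s3 s2 hv hv3 hv2
        (by simp only [pathLength]; omega),
      .of_three yvc zbv xvb.symm xvc D23 D12.symm D13.symm hb hc hbc s2 s3 s1 hv hv3 hv1
        (by simp only [pathLength]; omega)⟩

/-- The multiset `S` matches each face with the tree that results from expanding the corresponding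
leaf. Both projections are recorded with multiplicity, so that sums over faces become sums over
expansions. -/
theorem Represents.exists_expansions {t : TernaryTree} {a b c : ℕ} {V : Multiset ℕ}
    {F : Multiset (Finset ℕ)} (h : t.Represents a b c V F) (hF : ∀ f ∈ F, f.card = 3) (n : ℕ) :
    ∃ S : Multiset (Finset ℕ × TernaryTree), S.map Prod.fst = F ∧ S.map Prod.snd = t.expansions ∧
      ∀ p ∈ S, p.2.Represents a b c (n ::ₘ V)
        (F.erase p.1 + p.1.val.map fun v => insert n (p.1.erase v)) := by
  induction h with
  | leaf a b c =>
    refine ⟨{({a, b, c}, .node .leaf .leaf .leaf)}, rfl, rfl, fun p hp => ?_⟩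
    rw [Multiset.mem_singleton] at hp
    subst hp
    have h3 := hF _ (Multiset.mem_singleton_self _)
    obtain ⟨hab, hac, hbc⟩ : a ≠ b ∧ a ≠ c ∧ b ≠ c := by
      refine ⟨?_, ?_, ?_⟩ <;> rintro rfl <;>
      · have := Finset.card_le_two (a := a) (b := b)
        have := Finset.card_le_two (a := b) (b := a)
        have := Finset.card_le_two (a := a) (b := c)
        simp_all
        try omega
    have e := Represents.node (.leaf n b c) (.leaf a n c) (.leaf a b n)
    convert e using 1
    · rfl
    · have hval : ({a, b, c} : Finset ℕ).val = {a} + {b} + {c} := by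
        rw [Finset.insert_val_of_notMem (by simp [hab, hac]),
          Finset.insert_val_of_notMem (by simp [hbc])]
        rfl
      have ea : ({a, b, c} : Finset ℕ).erase a = {b, c} := by
        ext w; simp only [Finset.mem_erase, Finset.mem_insert, Finset.mem_singleton]; grind
      have eb : ({a, b, c} : Finset ℕ).erase b = {a, c} := by
        ext w; simp only [Finset.mem_erase, Finset.mem_insert, Finset.mem_singleton]; grind
      have ec : ({a, b, c} : Finset ℕ).erase c = {a, b} := by
        ext w; simp only [Finset.mem_erase, Finset.mem_insert, Finset.mem_singleton]; grind
      simp only [hval, Multiset.map_add, Multiset.map_singleton, ea, eb, ec]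
      rw [show ({{a, b, c}} : Multiset (Finset ℕ)).erase {a, b, c} = 0 by simp, zero_add,
        Finset.insert_comm n a {c}, Finset.insert_comm n a {b}, Finset.pair_comm n b]
  | @node x y z a b c v V₁ V₂ V₃ F₁ F₂ F₃ h₁ h₂ h₃ hx hy hz =>
    obtain ⟨S₁, f₁, s₁, r₁⟩ := hx fun f hf => hF f (by simp [hf])
    obtain ⟨S₂, f₂, s₂, r₂⟩ := hy fun f hf => hF f (by simp [hf])
    obtain ⟨S₃, f₃, s₃, r₃⟩ := hz fun f hf => hF f (by simp [hf])
    refine ⟨S₁.map (fun p => (p.1, .node p.2 y z)) + S₂.map (fun p => (p.1, .node x p.2 z)) +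
      S₃.map (fun p => (p.1, .node x y p.2)), ?_, ?_, fun p hp => ?_⟩
    · simp [f₁, f₂, f₃]
    · simp [expansions, ← s₁, ← s₂, ← s₃]
    · simp only [Multiset.mem_add, Multiset.mem_map] at hp
      rcases hp with (⟨q, hq, rfl⟩ | ⟨q, hq, rfl⟩) | ⟨q, hq, rfl⟩
      · have hm : q.1 ∈ F₁ := f₁ ▸ Multiset.mem_map_of_mem _ hq
        convert Represents.node (r₁ q hq) h₂ h₃ using 1
        · simp only [← Multiset.singleton_add]; abel
        · rw [add_assoc, Multiset.erase_add_left_pos _ hm]; abel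
      · have hm : q.1 ∈ F₂ := f₂ ▸ Multiset.mem_map_of_mem _ hq
        convert Represents.node h₁ (r₂ q hq) h₃ using 1
        · simp only [← Multiset.singleton_add]; abel
        · rw [add_comm F₁, add_assoc, Multiset.erase_add_left_pos _ hm]; abel
      · have hm : q.1 ∈ F₃ := f₃ ▸ Multiset.mem_map_of_mem _ hq
        convert Represents.node h₁ h₂ (r₃ q hq) using 1
        · simp only [← Multiset.singleton_add]; abel
        · rw [add_comm (F₁ + F₂), Multiset.erase_add_left_pos _ hm]; abel

end TernaryTree

/-! ### Transfer to random Apollonian networks -/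

open scoped ENNReal

namespace FacedGraph

/-- The tree `t` describes a sequence of subdivisions by which `G` arises from a triangle. -/
def Models (G : FacedGraph) (t : TernaryTree) : Prop :=
  ∃ V, t.Represents 0 1 2 V G.faces.val ∧ (0 ::ₘ 1 ::ₘ 2 ::ₘ V).Nodup ∧ (∀ w ∈ V, w < G.order) ∧
    3 ≤ G.order ∧ G.graph.Adj 2 0

theorem models_triangle : triangle.Models .leaf := by
  refine ⟨0, .leaf 0 1 2, by simp, by simp, le_rfl, ?_⟩
  simp [triangle, SimpleGraph.fromRel_adj]

theorem Models.card_faces {G : FacedGraph} {t : TernaryTree} (h : G.Models t) :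
    G.faces.card = t.leaves := by
  obtain ⟨V, hV, _⟩ := h
  exact hV.card_faces

theorem faces_val_subdivide (G : FacedGraph) (f : Finset ℕ) (hf : f ∈ G.faces) :
    (G.subdivide f hf).faces.val =
      G.faces.val.erase f + f.val.map fun v => insert G.order (f.erase v) := by
  have hnot : G.order ∉ f := fun h => lt_irrefl _ (G.face_lt f hf _ h)
  have hdisj : Disjoint (G.faces.erase f) (f.image fun v => insert G.order (f.erase v)) := by
    rw [Finset.disjoint_right]
    intro g hg hg'
    obtain ⟨w, _, rfl⟩ := Finset.mem_image.1 hg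
    exact lt_irrefl _ (G.face_lt _ (Finset.mem_of_mem_erase hg') _ (Finset.mem_insert_self _ _))
  have hinj : Set.InjOn (fun v => insert G.order (f.erase v)) (f : Set ℕ) := by
    intro u hu v hv h
    by_contra huv
    have h1 : u ∈ insert G.order (f.erase v) :=
      Finset.mem_insert_of_mem (Finset.mem_erase.2 ⟨huv, hu⟩)
    rw [← show insert G.order (f.erase u) = insert G.order (f.erase v) from h,
      Finset.mem_insert] at h1
    rcases h1 with h1 | h1
    · exact hnot (h1 ▸ hu)
    · exact Finset.notMem_erase u f h1
  change (G.faces.erase f ∪ f.image fun v => insert G.order (f.erase v)).val = _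
  rw [← Finset.disjUnion_eq_union _ _ hdisj, Finset.disjUnion_val, Finset.erase_val,
    Finset.image_val_of_injOn hinj]

theorem Models.exists_expansions {G : FacedGraph} {t : TernaryTree} (h : G.Models t) :
    ∃ S : Multiset (Finset ℕ × TernaryTree), S.map Prod.fst = G.faces.val ∧
      S.map Prod.snd = t.expansions ∧
      ∀ p ∈ S, ∃ hp : p.1 ∈ G.faces, (G.subdivide p.1 hp).Models p.2 := by
  obtain ⟨V, hV, hn, hlt, h3, hadj⟩ := h
  obtain ⟨S, hS1, hS2, hS⟩ := hV.exists_expansions (fun f hf => G.face_card f hf) G.order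
  refine ⟨S, hS1, hS2, fun p hp => ?_⟩
  have hpf : p.1 ∈ G.faces := by
    rw [← Finset.mem_val, ← hS1]
    exact Multiset.mem_map_of_mem _ hp
  refine ⟨hpf, G.order ::ₘ V, ?_, ?_, fun w hw => ?_, ?_, ?_⟩
  · rw [faces_val_subdivide]
    exact hS p hp
  · have hV : G.order ∉ V := fun h => lt_irrefl _ (hlt _ h)
    simp only [Multiset.nodup_cons, Multiset.mem_cons, not_or] at hn ⊢
    refine ⟨⟨hn.1.1, hn.1.2.1, by omega, hn.1.2.2⟩, ⟨hn.2.1.1, by omega, hn.2.1.2⟩,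
      ⟨by omega, hn.2.2.1⟩, hV, hn.2.2.2⟩
  · change w < G.order + 1
    rcases Multiset.mem_cons.1 hw with rfl | hw
    · omega
    · have := hlt w hw
      omega
  · change 3 ≤ G.order + 1
    omega
  · exact Or.inl hadj

theorem IsApollonian.exists_models {G : FacedGraph} (h : G.IsApollonian) :
    ∃ t, G.Models t := by
  induction h with
  | triangle => exact ⟨_, models_triangle⟩
  | subdivide G f hf _ ih =>
    obtain ⟨t, ht⟩ := ih
    obtain ⟨S, hS1, -, hS⟩ := ht.exists_expansions
    have hf' := hf
    rw [← Finset.mem_val, ← hS1, Multiset.mem_map] at hf'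
    obtain ⟨p, hp, rfl⟩ := hf'
    exact ⟨p.2, (hS p hp).2⟩

theorem length_support_le_order {G : FacedGraph} {u v : ℕ} {p : G.graph.Walk u v}
    (hp : p.IsPath) (h : ∀ w ∈ p.support, w < G.order) : p.support.length ≤ G.order := by
  rw [← List.toFinset_card_of_nodup hp.support_nodup]
  refine (Finset.card_le_card fun w hw => ?_).trans_eq (Finset.card_range G.order)
  exact Finset.mem_range.2 (h w (List.mem_toFinset.1 hw))

theorem longestPath_le_order (G : FacedGraph) : G.longestPath ≤ G.order := by
  rcases Set.eq_empty_or_nonempty {l : ℕ | ∃ (u v : ℕ) (p : G.graph.Walk u v),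
    p.IsPath ∧ (∀ w ∈ p.support, w < G.order) ∧ p.support.length = l} with h | h
  · rw [longestPath, h, csSup_empty]
    exact Nat.zero_le _
  · refine csSup_le h ?_
    rintro l ⟨u, v, p, hp, hlt, rfl⟩
    exact length_support_le_order hp hlt

theorem le_longestPath {G : FacedGraph} {u v : ℕ} {p : G.graph.Walk u v} (hp : p.IsPath)
    (h : ∀ w ∈ p.support, w < G.order) : p.support.length ≤ G.longestPath := by
  refine le_csSup ⟨G.order, ?_⟩ ⟨u, v, p, hp, h, rfl⟩
  rintro l ⟨u, v, p, hp, hlt, rfl⟩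
  exact length_support_le_order hp hlt

/-- The path from `0` to `1` avoids `2`, so the edge from `2` to `0` can be put in front; one
further vertex comes from counting vertices instead of edges. -/
theorem Models.pathLength_add_two_le {G : FacedGraph} {t : TernaryTree} (h : G.Models t) :
    t.pathLength + 2 ≤ G.longestPath := by
  obtain ⟨V, hV, hn, hlt, h3, hadj⟩ := h
  obtain ⟨⟨p, hp, hl, hS⟩, -⟩ := hV.hasLongPath hn fun f hf => G.face_clique f hf
  have h2 : 2 ∉ p.support := fun h => by
    rcases hS 2 h with h | h | h
    · omega
    · omega
    · simp only [Multiset.nodup_cons] at hn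
      exact hn.2.2.1 h
  have hq : (p.cons hadj).IsPath := hp.cons h2
  have hle := le_longestPath hq fun w hw => by
    rw [SimpleGraph.Walk.support_cons, List.mem_cons] at hw
    rcases hw with rfl | hw
    · omega
    · rcases hS w hw with rfl | rfl | h
      exacts [by omega, by omega, hlt w h]
  rw [SimpleGraph.Walk.length_support, SimpleGraph.Walk.length_cons] at hle
  omega

/-- The expectation of a function after one random subdivision. -/
noncomputable def stepMean (φ : FacedGraph → ℝ≥0∞) (G : FacedGraph) : ℝ≥0∞ :=
  (G.faces.card : ℝ≥0∞)⁻¹ * ∑ f ∈ G.faces.attach, φ (G.subdivide f.1 f.2)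

end FacedGraph

namespace PMF

variable {α β : Type*}

theorem tsum_pure_mul (a : α) (φ : α → ℝ≥0∞) : ∑' b, PMF.pure a b * φ b = φ a := by
  rw [tsum_eq_single a fun b hb => by simp [hb]]
  simp

theorem tsum_bind_mul (p : PMF α) (q : α → PMF β) (φ : β → ℝ≥0∞) :
    ∑' b, p.bind q b * φ b = ∑' a, p a * ∑' b, q a b * φ b := by
  simp only [PMF.bind_apply, ← ENNReal.tsum_mul_right, ← ENNReal.tsum_mul_left]
  rw [ENNReal.tsum_comm]
  simp only [mul_assoc]

theorem tsum_map_mul (p : PMF α) (g : α → β) (φ : β → ℝ≥0∞) :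
    ∑' b, p.map g b * φ b = ∑' a, p a * φ (g a) := by
  rw [← PMF.bind_pure_comp, tsum_bind_mul]
  simp only [Function.comp_apply, tsum_pure_mul]

end PMF

namespace FacedGraph

theorem tsum_randomStep_mul (G : FacedGraph) (φ : FacedGraph → ℝ≥0∞) :
    ∑' H, G.randomStep H * φ H = stepMean φ G := by
  rw [randomStep, PMF.tsum_map_mul, tsum_fintype, stepMean, Finset.mul_sum, Finset.univ_eq_attach]
  refine Finset.sum_congr rfl fun f hf => ?_
  rw [PMF.uniformOfFinset_apply_of_mem _ hf, Finset.card_attach]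

theorem tsum_randomApollonian_mul (k : ℕ) (φ : FacedGraph → ℝ≥0∞) :
    ∑' H, randomApollonian k H * φ H = stepMean^[k] φ triangle := by
  induction k generalizing φ with
  | zero => rw [randomApollonian, PMF.tsum_pure_mul]; rfl
  | succ k ih =>
    rw [randomApollonian, PMF.tsum_bind_mul, Function.iterate_succ_apply, ← ih]
    simp only [tsum_randomStep_mul]

theorem ofReal_multiset_sum_le (s : Multiset ℝ) :
    ENNReal.ofReal s.sum ≤ (s.map ENNReal.ofReal).sum := by
  induction s using Multiset.induction with
  | empty => simp
  | cons a s ih =>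
    rw [Multiset.sum_cons, Multiset.map_cons, Multiset.sum_cons]
    exact ENNReal.ofReal_add_le.trans (add_le_add_right ih _)

/-- The matching of faces with expansions couples one uniform step of the graph with one uniform
step of the tree. -/
theorem Models.le_stepMean {G : FacedGraph} {t : TernaryTree} (h : G.Models t)
    {ψ : TernaryTree → ℝ} {φ : FacedGraph → ℝ≥0∞}
    (hφ : ∀ (f : Finset ℕ) (hf : f ∈ G.faces) (s : TernaryTree), s ∈ t.expansions →
      (G.subdivide f hf).Models s → ENNReal.ofReal (ψ s) ≤ φ (G.subdivide f hf)) :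
    ENNReal.ofReal ((t.leaves : ℝ)⁻¹ * TernaryTree.growth ψ t) ≤ stepMean φ G := by
  obtain ⟨S, hS1, hS2, hS⟩ := h.exists_expansions
  have hpos : (0 : ℝ) < t.leaves := Nat.cast_pos.2 t.leaves_pos
  rw [stepMean, h.card_faces, ENNReal.ofReal_mul (inv_nonneg.2 hpos.le),
    ENNReal.ofReal_inv_of_pos hpos, ENNReal.ofReal_natCast]
  gcongr
  have hsum : ∑ f ∈ G.faces.attach, φ (G.subdivide f.1 f.2) =
      ∑ f ∈ G.faces, if hf : f ∈ G.faces then φ (G.subdivide f hf) else 0 := by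
    rw [← Finset.sum_attach G.faces]
    refine Finset.sum_congr rfl fun f _ => ?_
    rw [dif_pos f.2]
  rw [hsum, TernaryTree.growth_apply, Finset.sum, ← hS1, ← hS2, Multiset.map_map,
    Multiset.map_map]
  refine (ofReal_multiset_sum_le _).trans ?_
  rw [Multiset.map_map]
  refine Multiset.sum_map_le_sum_map _ _ fun p hp => ?_
  obtain ⟨hpf, hm⟩ := hS p hp
  simp only [Function.comp_apply]
  rw [dif_pos hpf]
  exact hφ p.1 hpf p.2 (hS2 ▸ Multiset.mem_map_of_mem _ hp) hm

/-- Starting from a general pair `G`, `t` is needed for the induction, which conditions on the first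
step; the product counts the expansion sequences from `t`. -/
theorem Models.le_iterate_stepMean {ψ : TernaryTree → ℝ} {φ : FacedGraph → ℝ≥0∞}
    (hφ : ∀ G t, Models G t → ENNReal.ofReal (ψ t) ≤ φ G) (k : ℕ) {G : FacedGraph}
    {t : TernaryTree} (h : G.Models t) :
    ENNReal.ofReal ((∏ j ∈ Finset.range k, (2 * (j : ℝ) + t.leaves))⁻¹ *
      (TernaryTree.growth ^ k) ψ t) ≤ stepMean^[k] φ G := by
  induction k generalizing G t with
  | zero => simpa using hφ G t h
  | succ k ih =>
    rw [Function.iterate_succ_apply']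
    refine le_trans (le_of_eq ?_) (h.le_stepMean (ψ := (∏ j ∈ Finset.range k,
      (2 * ((j + 1 : ℕ) : ℝ) + t.leaves))⁻¹ • (TernaryTree.growth ^ k) ψ)
      fun f hf s hs hm => ?_)
    · rw [map_smul, Finset.prod_range_succ', pow_succ', Module.End.mul_apply, Pi.smul_apply,
        smul_eq_mul, mul_inv]
      congr 1
      simp only [Nat.cast_zero, mul_zero, zero_add]
      ring
    · refine le_trans (le_of_eq ?_) (ih hm)
      rw [Pi.smul_apply, smul_eq_mul, TernaryTree.leaves_of_mem_expansions hs]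
      congr 3
      refine Finset.prod_congr rfl fun j _ => ?_
      push_cast
      ring

theorem order_of_mem_support (k : ℕ) (G : FacedGraph) (hG : G ∈ (randomApollonian k).support) :
    G.order = k + 3 := by
  induction k generalizing G with
  | zero =>
    rw [randomApollonian, PMF.mem_support_pure_iff] at hG
    subst hG
    rfl
  | succ k ih =>
    rw [randomApollonian, PMF.mem_support_bind_iff] at hG
    obtain ⟨H, hH, hG⟩ := hG
    rw [randomStep, PMF.mem_support_map_iff] at hG
    obtain ⟨f, _, rfl⟩ := hG
    have := ih H hH
    change H.order + 1 = _
    omega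

theorem integral_longestPathLaw (k : ℕ) :
    ∫ l : ℕ, (l : ℝ) ∂(longestPathLaw k).toMeasure =
      (∑' G, randomApollonian k G * (G.longestPath : ℝ≥0∞)).toReal := by
  rw [MeasureTheory.integral_eq_lintegral_of_nonneg_ae (Filter.Eventually.of_forall fun l =>
    Nat.cast_nonneg l) (measurable_of_countable _).aestronglyMeasurable]
  congr 1
  rw [MeasureTheory.lintegral_countable', ← PMF.tsum_map_mul _ longestPath fun l => (l : ℝ≥0∞)]
  refine tsum_congr fun l => ?_
  rw [PMF.toMeasure_apply_singleton _ _ (measurableSet_singleton l), ENNReal.ofReal_natCast,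
    mul_comm]
  rfl

/-- Finiteness is needed because the real integral would otherwise take the default value `0`; it
holds since the order is almost surely `k + 3`. -/
theorem tsum_randomApollonian_longestPath_ne_top (k : ℕ) :
    ∑' G, randomApollonian k G * (G.longestPath : ℝ≥0∞) ≠ ∞ := by
  refine ne_top_of_le_ne_top (ENNReal.natCast_ne_top (k + 3)) ?_
  calc ∑' G, randomApollonian k G * (G.longestPath : ℝ≥0∞)
      ≤ ∑' G, randomApollonian k G * ((k + 3 : ℕ) : ℝ≥0∞) := by
        refine ENNReal.tsum_le_tsum fun G => ?_
        by_cases hG : G ∈ (randomApollonian k).support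
        · gcongr
          exact G.longestPath_le_order.trans_eq (order_of_mem_support k G hG)
        · rw [(PMF.apply_eq_zero_iff _ _).2 hG, zero_mul, zero_mul]
    _ = _ := by rw [ENNReal.tsum_mul_right, PMF.tsum_coe, one_mul]

theorem meanPathLength_le_integral (k : ℕ) :
    TernaryTree.meanPathLength k ≤ ∫ l : ℕ, (l : ℝ) ∂(longestPathLaw k).toMeasure := by
  rw [integral_longestPathLaw, ← ENNReal.ofReal_le_iff_le_toReal
    (tsum_randomApollonian_longestPath_ne_top k), tsum_randomApollonian_mul]
  refine le_trans (le_of_eq ?_) (models_triangle.le_iterate_stepMean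
    (ψ := fun t => t.pathLength) (fun G t h => ?_) k)
  · rw [TernaryTree.meanPathLength, TernaryTree.mean_apply]
    simp [TernaryTree.histories, TernaryTree.leaves]
  · rw [ENNReal.ofReal_natCast]
    exact Nat.cast_le.2 ((Nat.le_add_right _ 2).trans h.pathLength_add_two_le)

end FacedGraph

theorem theorem2 :
    (∀ (m : ℕ) (G : FacedGraph), G.IsApollonian → G.faces.card = m →
      (m : ℝ) ^ (Real.log 2 / Real.log 3) + 2 ≤ (G.longestPath : ℝ)) ∧
    (∃ c : ℝ, 0 < c ∧ ∀ m k : ℕ, m = 2 * k + 1 →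
      c * (m : ℝ) ^ (0.88 : ℝ) ≤
        ∫ l : ℕ, (l : ℝ) ∂(FacedGraph.longestPathLaw k).toMeasure) := by
  refine ⟨fun m G hG hm => ?_, (TernaryTree.potential 80)⁻¹,
    inv_pos.2 (TernaryTree.potential_pos 80), fun m k hm => ?_⟩
  · obtain ⟨t, ht⟩ := hG.exists_models
    rw [← hm, ht.card_faces]
    have h : (t.pathLength : ℝ) + 2 ≤ G.longestPath := by
      exact_mod_cast ht.pathLength_add_two_le
    linarith [t.rpow_leaves_le_pathLength]
  · subst hm
    push_cast
    exact (TernaryTree.rpow_le_meanPathLength k).trans (FacedGraph.meanPathLength_le_integral k)
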